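/- Consider a single sensor whose channel state $q(t)$ is an irreducible (for instance, ergodic) Markov chain on a finite non-empty set with transition probabilities $p_{q,q'}$. Let $\omega(q)\ge 0$ be the power consumed by a transmission in channel state $q$, let $W\ge 0$ be a scheduling penalty, and let $\lambda\ge 0$ be a fixed power multiplier. The state is $(x,q)$, where $x\in\{1,2,\dots\}$ is the age of information. In every slot an action $s\in\{0,1\}$ is chosen ($s=1$: the sensor is scheduled). The age becomes $1$ if $s=1$ and $x+1$ if $s=0$, while $q$ moves according to $p$; the one-step cost is $x+Ws+\lambda\omega(q)s$. A policy may be randomized and may depend on the whole past and present (it is non-anticipative). A stationary deterministic policy is a map $s^*(x,q)\in\{0,1\}$. A policy is average-cost optimal from a given initial state, with value $\gamma$, if its average cost $\frac1T\mathbb{E}\big[\sum_{t=1}^{T}(x(t)+Ws(t)+\lambda\omega(q(t))s(t))\big]$ converges to $\gamma$ as $T\to\infty$, and the $\liminf$ of the average costs of every non-anticipative policy is at least $\gamma$. Consider the Bellman equation $$V(x,q)+\gamma=\min\Big\{x+\sum_{q'}p_{q,q'}V(x+1,q'),\; x+W+\lambda\omega(q)+\sum_{q'}p_{q,q'}V(1,q')\Big\}$$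 with $\gamma\in\mathbb{R}$ and $V$ real-valued and bounded below. Then: 1. The equation has a solution $(\gamma,V)$, and there is a stationary deterministic policy attaining the minimum in every state. 2. For every such solution $(\gamma,V)$, every stationary deterministic policy $s^*$ attaining the minimum in every state is average-cost optimal, with value $\gamma$, from every initial state, and it has a threshold structure: for each channel state $q$ there is a finite threshold $\tau_q\in\{1,2,\dots\}$ such that $s^*(x,q)=1$ if $x\ge\tau_q$ and $s^*(x,q)=0$ if $x<\tau_q$. 3. For every stationary deterministic policy $s^*$ that is average-cost optimal from some given initial state, there are finite thresholds $\tau_q$ such that $s^*(x,q)=1$ if $x\ge\tau_q$ and $s^*(x,q)=0$ if $x<\tau_q$, at every state $(x,q)$ that $s^*$ visits with positive long-run frequency from that initial state (that is, the expected proportion of the first $T$ slots spent in $(x,q)$ does not tend to $0$ as $T\to\infty$). -/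

import Mathlib

open Filter Topology

noncomputable section

namespace AoI

universe u

/-- A state `(x, q)`: the age of information `x ≥ 1` and the channel state `q`. -/
abbrev State (Q : Type u) : Type u := ℕ+ × Q

/-- The data of the single-sensor decision problem. Actions are Booleans: `true` means that the
sensor is scheduled, `false` that it stays idle. -/
structure Model (Q : Type u) where
  /-- transition law of the channel: `P q q'` is the probability of moving from `q` to `q'` -/
  P : Q → PMF Q
  /-- power `ω q` consumed by a transmission in channel state `q` -/
  ω : Q → ℝ
  /-- scheduling penalty -/
  W : ℝ
  /-- multiplier of the power consumption -/
  lam : ℝ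

/-- The action as a number in `{0, 1}`. -/
def act (s : Bool) : ℝ := if s then 1 else 0

/-- The age after one slot: it drops to `1` if the sensor is scheduled and grows by `1` if not. -/
def nextAge (x : ℕ+) (s : Bool) : ℕ+ := if s then 1 else x + 1

/-- What the controller has observed: the past state-action pairs (the most recent one first)
and the current state. -/
structure History (Q : Type u) where
  past : List (State Q × Bool)
  cur : State Q

/-- A non-anticipative, possibly randomized policy: it chooses the law of the action from the
whole observed history (whose length also tells the time). -/
abbrev Policy (Q : Type u) : Type u := History Q → PMF Bool

/-- The stationary deterministic policy that takes action `a (x, q)` in state `(x, q)`. -/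
def stationary {Q : Type u} (a : State Q → Bool) : Policy Q := fun h => PMF.pure (a h.cur)

/-- Expectation of a real function under a discrete law. It is used below only for laws of finite
support (over a finite set of channel states). -/
def expect {α : Type u} (μ : PMF α) (f : α → ℝ) : ℝ := ∑' y, (μ y).toReal * f y

namespace Model

variable {Q : Type u} (M : Model Q)

/-- The channel is irreducible: every channel state can be reached from every other one through
transitions of positive probability. -/
def Irreducible : Prop :=
  ∀ i j : Q, Relation.ReflTransGen (fun k l => M.P k l ≠ 0) i j

/-- One-step cost `x + W s + lam ω(q) s`. -/
def cost (z : State Q) (s : Bool) : ℝ :=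
  ((z.1 : ℕ) : ℝ) + M.W * act s + M.lam * (M.ω z.2 * act s)

/-- One slot: an action is drawn from the policy, then the channel moves and the age is updated. -/
def step (π : Policy Q) (h : History Q) : PMF (History Q) :=
  (π h).bind fun s =>
    (M.P h.cur.2).map fun q' => ⟨(h.cur, s) :: h.past, (nextAge h.cur.1 s, q')⟩

/-- The law of the history after `T` slots, from the initial state `z₀`, under the policy `π`. -/
def law (π : Policy Q) (z₀ : State Q) : ℕ → PMF (History Q)
  | 0 => PMF.pure ⟨[], z₀⟩
  | T + 1 => (law π z₀ T).bind (M.step π)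

/-- `(1 / T) E_π [∑ f(x(t), q(t), s(t))]`, the sum being over the first `T` slots. -/
def average (π : Policy Q) (z₀ : State Q) (f : State Q → Bool → ℝ) (T : ℕ) : ℝ :=
  (1 / (T : ℝ)) * expect (M.law π z₀ T) fun h => (h.past.map fun e => f e.1 e.2).sum

/-- The policy `π` minimizes the long-run average cost from the initial state `z₀` over all
non-anticipative policies, and the minimal value is `γ`. Under `π` the limit of the average costs
exists; the other policies are compared through their lower limit. -/
def IsOptimalFrom (π : Policy Q) (z₀ : State Q) (γ : ℝ) : Prop :=
  Tendsto (M.average π z₀ M.cost) atTop (𝓝 γ) ∧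
    ∀ π' : Policy Q,
      (γ : EReal) ≤ liminf (fun T : ℕ => ((M.average π' z₀ M.cost T : ℝ) : EReal)) atTop

open Classical in
/-- Under `π`, started in `z₀`, the state `z` is visited with positive long-run frequency: the
expected proportion of the first `T` slots spent in `z` does not tend to `0`. -/
def VisitedFrom (π : Policy Q) (z₀ z : State Q) : Prop :=
  ¬ Tendsto (M.average π z₀ fun y _ => if y = z then 1 else 0) atTop (𝓝 0)

/-- Cost of taking action `s` now plus the expected value of `V` at the next state. -/
def actionValue [Fintype Q] (V : State Q → ℝ) (z : State Q) (s : Bool) : ℝ :=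
  M.cost z s + ∑ q' : Q, (M.P z.2 q').toReal * V (nextAge z.1 s, q')

/-- `V` is a differential cost-to-go function with average cost `γ`: it is bounded below and
satisfies the average-cost Bellman equation. (Without the lower bound the equation also has
spurious solutions, which tend to `-∞` as the age grows.) -/
def IsBellmanSolution [Fintype Q] (γ : ℝ) (V : State Q → ℝ) : Prop :=
  (∃ B : ℝ, ∀ z, B ≤ V z) ∧
    ∀ z, V z + γ = min (M.actionValue V z false) (M.actionValue V z true)

/-- In every state the action `a z` attains the minimum in the Bellman equation. -/
def AttainsBellman [Fintype Q] (γ : ℝ) (V : State Q → ℝ) (a : State Q → Bool) : Prop :=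
  ∀ z, M.actionValue V z (a z) = V z + γ

end Model

end AoI

end

/-! A solution `V` that is bounded below lies within a constant of the age, and iterating the
Bellman equation sharpens this to slope at least one in the age (`IsBellmanSolution.add_one_le`).
Idling therefore loses ground to scheduling at a rate of at least one per unit of age, which gives
finite thresholds whatever the tie-breaking.

Optimality is a telescoping argument (`drift_le_average`). It needs a test function bounded above,
which `V` is not, so a small multiple of the squared age is subtracted and paid for by inflating the
cost by a factor `1 + δ` (`IsBellmanSolution.exists_lyapunov`). The same estimate keeps track of the
Bellman gap: a state visited with positive frequency cannot carry a suboptimal action if the average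
cost is `γ`. An optimal policy can thus be corrected off those states to attain the minimum
everywhere.

Existence is the vanishing discount method. Irreducibility bounds the relative discounted values at
age one uniformly (`Irreducible.exists_bound`), and one scheduling carries the bound to every age.
-/

noncomputable section

namespace AoI

/-! ### Expectations under finitely supported laws. -/

section Expectation

variable {α : Type*} {β : Type*}

theorem expect_eq_sum {μ : PMF α} {t : Finset α} (ht : μ.support ⊆ t) (f : α → ℝ) :
    expect μ f = ∑ y ∈ t, (μ y).toReal * f y := by
  refine tsum_eq_sum fun y hy => ?_
  have : μ y = 0 := by
    by_contra h
    exact hy (ht ((PMF.mem_support_iff _ _).2 h))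
  simp [this]

theorem expect_eq_sum_univ [Fintype α] (μ : PMF α) (f : α → ℝ) :
    expect μ f = ∑ y, (μ y).toReal * f y :=
  expect_eq_sum (by simp) f

theorem expect_pure (a : α) (f : α → ℝ) : expect (PMF.pure a) f = f a := by
  rw [expect_eq_sum (t := {a}) (by simp)]
  simp

theorem expect_const {μ : PMF α} (hμ : μ.support.Finite) (c : ℝ) :
    expect μ (fun _ => c) = c := by
  have ht : μ.support ⊆ hμ.toFinset := by simp
  rw [expect_eq_sum ht, ← Finset.sum_mul]
  have h1 : ∑ y ∈ hμ.toFinset, μ y = 1 := by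
    rw [← μ.tsum_coe]
    refine (tsum_eq_sum fun y hy => ?_).symm
    by_contra h
    exact hy (ht ((PMF.mem_support_iff _ _).2 h))
  rw [← ENNReal.toReal_sum fun y _ => μ.apply_ne_top y, h1]
  simp

theorem expect_mono {μ : PMF α} (hμ : μ.support.Finite) {f g : α → ℝ}
    (h : ∀ y ∈ μ.support, f y ≤ g y) : expect μ f ≤ expect μ g := by
  have ht : μ.support ⊆ hμ.toFinset := by simp
  rw [expect_eq_sum ht, expect_eq_sum ht]
  refine Finset.sum_le_sum fun y hy => ?_
  exact mul_le_mul_of_nonneg_left (h y (by simpa using hy)) ENNReal.toReal_nonneg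

theorem expect_linear {μ : PMF α} (hμ : μ.support.Finite) (f g : α → ℝ) (a b : ℝ) :
    expect μ (fun y => a * f y + b * g y) = a * expect μ f + b * expect μ g := by
  have ht : μ.support ⊆ hμ.toFinset := by simp
  rw [expect_eq_sum ht, expect_eq_sum ht, expect_eq_sum ht, Finset.mul_sum, Finset.mul_sum,
    ← Finset.sum_add_distrib]
  exact Finset.sum_congr rfl fun y _ => by ring

theorem finite_support_bind {μ : PMF α} {κ : α → PMF β} (hμ : μ.support.Finite)
    (hκ : ∀ a, (κ a).support.Finite) : (μ.bind κ).support.Finite := by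
  rw [PMF.support_bind]
  exact hμ.biUnion fun a _ => hκ a

theorem expect_bind {μ : PMF α} {κ : α → PMF β} (hμ : μ.support.Finite)
    (hκ : ∀ a, (κ a).support.Finite) (f : β → ℝ) :
    expect (μ.bind κ) f = expect μ fun a => expect (κ a) f := by
  classical
  have hb := finite_support_bind hμ hκ
  have ht : μ.support ⊆ hμ.toFinset := by simp
  have hs : (μ.bind κ).support ⊆ hb.toFinset := by simp
  rw [expect_eq_sum hs, expect_eq_sum ht]
  have h1 : ∀ a ∈ hμ.toFinset, (μ a).toReal * expect (κ a) f =
      ∑ y ∈ hb.toFinset, (μ a).toReal * ((κ a y).toReal * f y) := by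
    intro a ha
    rw [expect_eq_sum (t := hb.toFinset), Finset.mul_sum]
    intro y hy
    simp only [Set.Finite.coe_toFinset, PMF.support_bind, Set.mem_iUnion]
    exact ⟨a, by simpa using ha, hy⟩
  rw [Finset.sum_congr rfl h1, Finset.sum_comm]
  refine Finset.sum_congr rfl fun y _ => ?_
  have h2 : μ.bind κ y = ∑ a ∈ hμ.toFinset, μ a * κ a y := by
    rw [PMF.bind_apply]
    refine tsum_eq_sum fun a ha => ?_
    have : μ a = 0 := by
      by_contra h
      exact ha (ht ((PMF.mem_support_iff _ _).2 h))
    simp [this]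
  rw [h2, ENNReal.toReal_sum fun a _ => ENNReal.mul_ne_top (μ.apply_ne_top a) ((κ a).apply_ne_top y),
    Finset.sum_mul]
  exact Finset.sum_congr rfl fun a _ => by rw [ENNReal.toReal_mul, mul_assoc]

theorem expect_map [Finite α] (μ : PMF α) (g : α → β) (f : β → ℝ) :
    expect (μ.map g) f = expect μ (f ∘ g) := by
  rw [PMF.map, expect_bind (Set.toFinite _) (fun a => by simp)]
  simp [expect_pure, Function.comp_def]

end Expectation

/-! ### Average costs and the drift inequality. -/

namespace Model

theorem average_nonneg {Q : Type*} (M : Model Q) (π : Policy Q) (z₀ : State Q) {f : State Q → Bool → ℝ}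
    (hf : ∀ z s, 0 ≤ f z s) (T : ℕ) : 0 ≤ M.average π z₀ f T := by
  refine mul_nonneg (by positivity) (tsum_nonneg fun h => mul_nonneg ENNReal.toReal_nonneg ?_)
  refine List.sum_nonneg fun y hy => ?_
  obtain ⟨e, -, rfl⟩ := List.mem_map.1 hy
  exact hf _ _

theorem IsOptimalFrom.le {Q : Type*} {M : Model Q} {π π' : Policy Q} {z₀ : State Q} {γ γ' : ℝ}
    (h : M.IsOptimalFrom π z₀ γ) (h' : M.IsOptimalFrom π' z₀ γ') : γ ≤ γ' := by
  have h1 := h.2 π'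
  have h2 : Tendsto (fun T => ((M.average π' z₀ M.cost T : ℝ) : EReal)) atTop (𝓝 (γ' : EReal)) :=
    (continuous_coe_real_ereal.tendsto γ').comp h'.1
  rw [h2.liminf_eq] at h1
  exact EReal.coe_le_coe_iff.1 h1

variable {Q : Type*} [Fintype Q] (M : Model Q)

theorem finite_support_step (π : Policy Q) (h : History Q) : (M.step π h).support.Finite := by
  refine finite_support_bind (Set.toFinite _) fun s => ?_
  rw [PMF.support_map]
  exact (Set.toFinite _).image _

theorem finite_support_law (π : Policy Q) (z₀ : State Q) (T : ℕ) :
    (M.law π z₀ T).support.Finite := by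
  induction T with
  | zero => simp [law]
  | succ T ih => exact finite_support_bind ih (M.finite_support_step π)

theorem expect_step (π : Policy Q) (h : History Q) (f : History Q → ℝ) :
    expect (M.step π h) f = expect (π h) fun s => ∑ q', (M.P h.cur.2 q').toReal *
      f ⟨(h.cur, s) :: h.past, (nextAge h.cur.1 s, q')⟩ := by
  rw [step, expect_bind (Set.toFinite _)]
  · simp only [expect_map, expect_eq_sum_univ, Function.comp_def]
  · intro s
    rw [PMF.support_map]
    exact (Set.toFinite _).image _

theorem sum_toReal_P (q : Q) : ∑ q', (M.P q q').toReal = 1 := by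
  have := expect_const (μ := M.P q) (Set.toFinite _) 1
  simpa [expect_eq_sum_univ] using this

/-- Dynkin-type inequality: a drift condition on `U` bounds expected accumulated rewards. -/
theorem drift_le_expect_law {π : Policy Q} {z₀ : State Q} {f : State Q → Bool → ℝ}
    {U : State Q → ℝ} {γ : ℝ}
    (hU : ∀ h : History Q, ∀ s ∈ (π h).support, U h.cur + γ ≤
      f h.cur s + ∑ q', (M.P h.cur.2 q').toReal * U (nextAge h.cur.1 s, q')) (T : ℕ) :
    U z₀ + T * γ ≤
      expect (M.law π z₀ T) fun h => (h.past.map fun e => f e.1 e.2).sum + U h.cur := by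
  induction T with
  | zero => simp [law, expect_pure]
  | succ T ih =>
    rw [law, expect_bind (M.finite_support_law π z₀ T) (M.finite_support_step π)]
    have key : expect (M.law π z₀ T)
        (fun h => 1 * ((h.past.map fun e => f e.1 e.2).sum + U h.cur) + 1 * γ) ≤
        expect (M.law π z₀ T) fun h => expect (M.step π h)
          fun h => (h.past.map fun e => f e.1 e.2).sum + U h.cur := by
      refine expect_mono (M.finite_support_law π z₀ T) fun h _ => ?_
      rw [expect_step, ← expect_const (μ := π h) (Set.toFinite _)
        (1 * ((h.past.map fun e => f e.1 e.2).sum + U h.cur) + 1 * γ)]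
      refine expect_mono (Set.toFinite _) fun s hs => ?_
      have h1 := hU h s hs
      simp only [List.map_cons, List.sum_cons, mul_add, Finset.sum_add_distrib,
        ← Finset.sum_mul, M.sum_toReal_P]
      linarith
    rw [expect_linear (M.finite_support_law π z₀ T)
      (fun h => (h.past.map fun e => f e.1 e.2).sum + U h.cur) (fun _ => γ),
      expect_const (M.finite_support_law π z₀ T)] at key
    push_cast
    linarith

/-- The bound on `U` is needed only from above, to discard the terminal term; it costs `O(1 / T)`.
-/
theorem drift_le_average {π : Policy Q} {z₀ : State Q} {f : State Q → Bool → ℝ}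
    {U : State Q → ℝ} {γ S : ℝ}
    (hU : ∀ h : History Q, ∀ s ∈ (π h).support, U h.cur + γ ≤
      f h.cur s + ∑ q', (M.P h.cur.2 q').toReal * U (nextAge h.cur.1 s, q'))
    (hS : ∀ z, U z ≤ S) {T : ℕ} (hT : T ≠ 0) :
    γ + (U z₀ - S) * (1 / (T : ℝ)) ≤ M.average π z₀ f T := by
  have hfin := M.finite_support_law π z₀ T
  have h1 := M.drift_le_expect_law (z₀ := z₀) hU T
  have h2 : expect (M.law π z₀ T) (fun h => (h.past.map fun e => f e.1 e.2).sum + U h.cur) ≤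
      expect (M.law π z₀ T) (fun h => 1 * (h.past.map fun e => f e.1 e.2).sum + 1 * S) :=
    expect_mono hfin fun h _ => by linarith [hS h.cur]
  rw [expect_linear hfin (fun h => (h.past.map fun e => f e.1 e.2).sum) (fun _ => S),
    expect_const hfin] at h2
  have hT' : (0 : ℝ) < T := by positivity
  rw [average]
  calc γ + (U z₀ - S) * (1 / (T : ℝ)) = 1 / (T : ℝ) * (U z₀ + T * γ - S) := by
        field_simp
        ring
    _ ≤ _ := by
        gcongr
        linarith

theorem average_linear (π : Policy Q) (z₀ : State Q) (f g : State Q → Bool → ℝ) (a b : ℝ)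
    (T : ℕ) : M.average π z₀ (fun z s => a * f z s + b * g z s) T =
      a * M.average π z₀ f T + b * M.average π z₀ g T := by
  have h : (fun h : History Q => (h.past.map fun e => a * f e.1 e.2 + b * g e.1 e.2).sum) =
      fun h => a * (h.past.map fun e => f e.1 e.2).sum +
        b * (h.past.map fun e => g e.1 e.2).sum := by
    funext h
    induction h.past with
    | nil => simp
    | cons e l ih =>
      simp only [List.map_cons, List.sum_cons, ih]
      ring
  rw [average, average, average, h, expect_linear (M.finite_support_law π z₀ T)]
  ring

end Model

/-! ### Bellman solutions: growth, thresholds and optimality. -/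

namespace Model

variable {Q : Type*} [Fintype Q] (M : Model Q)

theorem actionValue_false (V : State Q → ℝ) (x : ℕ+) (q : Q) :
    M.actionValue V (x, q) false =
      ((x : ℕ) : ℝ) + ∑ q', (M.P q q').toReal * V (x + 1, q') := by
  simp [actionValue, cost, act, nextAge]

theorem actionValue_true (V : State Q → ℝ) (x : ℕ+) (q : Q) :
    M.actionValue V (x, q) true = ((x : ℕ) : ℝ) + (M.W + M.lam * M.ω q) +
      ∑ q', (M.P q q').toReal * V (1, q') := by
  simp [actionValue, cost, act, nextAge, add_assoc]

theorem sum_P_mul_mono (q : Q) {f g : Q → ℝ} (h : ∀ q', f q' ≤ g q') :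
    ∑ q', (M.P q q').toReal * f q' ≤ ∑ q', (M.P q q').toReal * g q' :=
  Finset.sum_le_sum fun q' _ => mul_le_mul_of_nonneg_left (h q') ENNReal.toReal_nonneg

theorem sum_P_mul_const (q : Q) (c : ℝ) : ∑ q', (M.P q q').toReal * c = c := by
  rw [← Finset.sum_mul, M.sum_toReal_P, one_mul]

theorem sum_P_mul_add_const (q : Q) (f : Q → ℝ) (c : ℝ) :
    ∑ q', (M.P q q').toReal * (f q' + c) = ∑ q', (M.P q q').toReal * f q' + c := by
  simp only [mul_add, Finset.sum_add_distrib, M.sum_P_mul_const]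

variable {M} {γ : ℝ} {V : State Q → ℝ}

theorem IsBellmanSolution.exists_le_age_add (hV : M.IsBellmanSolution γ V) :
    ∃ C : ℝ, ∀ x q, V (x, q) ≤ ((x : ℕ) : ℝ) + C := by
  obtain ⟨C, hC⟩ := (Set.finite_range fun q =>
    M.W + M.lam * M.ω q + ∑ q', (M.P q q').toReal * V (1, q') - γ).bddAbove
  refine ⟨C, fun x q => ?_⟩
  have h1 := hV.2 (x, q)
  have h2 := min_le_right (M.actionValue V (x, q) false) (M.actionValue V (x, q) true)
  have h3 := hC ⟨q, rfl⟩
  rw [← h1, M.actionValue_true] at h2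
  dsimp only at h3
  linarith

theorem IsBellmanSolution.exists_age_add_le (hK : ∀ q, 0 ≤ M.W + M.lam * M.ω q)
    (hV : M.IsBellmanSolution γ V) : ∃ L : ℝ, ∀ (x : ℕ+) q, ((x : ℕ) : ℝ) + L ≤ V (x, q) := by
  obtain ⟨B, hB⟩ := hV.1
  refine ⟨B - γ, fun x q => ?_⟩
  have h1 := hV.2 (x, q)
  have h2 : ((x : ℕ) : ℝ) + B ≤
      min (M.actionValue V (x, q) false) (M.actionValue V (x, q) true) := by
    rw [M.actionValue_true, M.actionValue_false, le_min_iff]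
    have hb : ∀ y : ℕ+, B ≤ ∑ q', (M.P q q').toReal * V (y, q') := fun y => by
      rw [← M.sum_P_mul_const q B]
      exact M.sum_P_mul_mono q fun q' => hB _
    constructor <;> linarith [hb 1, hb (x + 1), hK q]
  linarith

/-- The two linear bounds give a possibly negative lower bound on the increments. Each pass through
the Bellman equation raises it by one, up to the cap 1: the idle branches gain 1 plus the previous
bound, the scheduling branches exactly 1. -/
theorem IsBellmanSolution.add_one_le (hK : ∀ q, 0 ≤ M.W + M.lam * M.ω q)
    (hV : M.IsBellmanSolution γ V) (x : ℕ+) (q : Q) : V (x, q) + 1 ≤ V (x + 1, q) := by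
  obtain ⟨C, hC⟩ := hV.exists_le_age_add
  obtain ⟨L, hL⟩ := hV.exists_age_add_le hK
  have key : ∀ (k : ℕ) (x : ℕ+) (q : Q), V (x, q) + min 1 (L - C + k) ≤ V (x + 1, q) := by
    intro k
    induction k with
    | zero =>
      intro x q
      have h1 := hC x q
      have h2 := hL (x + 1) q
      have h3 := min_le_right 1 (L - C + ((0 : ℕ) : ℝ))
      push_cast at h2 h3 ⊢
      linarith
    | succ k ih =>
      intro x q
      have h1 := M.sum_P_mul_mono q fun q' => ih (x + 1) q'
      rw [M.sum_P_mul_add_const] at h1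
      have h2 := hV.2 (x, q)
      have h3 := hV.2 (x + 1, q)
      rw [M.actionValue_true, M.actionValue_false] at h2 h3
      push_cast at h3 ⊢
      grind
  obtain ⟨k, hk⟩ := exists_nat_ge (1 - (L - C))
  have h := key k x q
  rwa [min_eq_left (by linarith)] at h

theorem IsBellmanSolution.add_sub_le (hK : ∀ q, 0 ≤ M.W + M.lam * M.ω q)
    (hV : M.IsBellmanSolution γ V) {x y : ℕ+} (hxy : x ≤ y) (q : Q) :
    V (x, q) + (((y : ℕ) : ℝ) - ((x : ℕ) : ℝ)) ≤ V (y, q) := by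
  induction y using PNat.recOn with
  | one =>
    obtain rfl : x = 1 := le_antisymm hxy one_le
    simp
  | succ y ih =>
    rcases hxy.eq_or_lt with rfl | h
    · simp
    · have h1 := ih (PNat.lt_add_one_iff.1 h)
      have h2 := hV.add_one_le hK y q
      push_cast
      linarith

/-- The idle value minus the scheduling value increases strictly with the age, at least linearly.
Strictness gives upward closure even under ties; linear growth rules out idling forever. -/
theorem IsBellmanSolution.exists_threshold (hK : ∀ q, 0 ≤ M.W + M.lam * M.ω q)
    (hV : M.IsBellmanSolution γ V) {a : State Q → Bool} (ha : M.AttainsBellman γ V a) :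
    ∃ τ : Q → ℕ+, ∀ (x : ℕ+) (q : Q), a (x, q) = true ↔ τ q ≤ x := by
  classical
  have hgap : ∀ (x y : ℕ+) (q : Q), x ≤ y →
      ∑ q', (M.P q q').toReal * V (x + 1, q') + (((y : ℕ) : ℝ) - ((x : ℕ) : ℝ)) ≤
        ∑ q', (M.P q q').toReal * V (y + 1, q') := by
    intro x y q hxy
    rw [← M.sum_P_mul_add_const]
    refine M.sum_P_mul_mono q fun q' => ?_
    have := hV.add_sub_le hK (add_le_add_left hxy 1) q'
    push_cast at this
    linarith
  have hle : ∀ x q, V (x, q) + γ ≤ M.actionValue V (x, q) false ∧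
      V (x, q) + γ ≤ M.actionValue V (x, q) true := fun x q => le_min_iff.1 (hV.2 (x, q)).le
  have hup : ∀ (x y : ℕ+) (q : Q), a (x, q) = true → x ≤ y → a (y, q) = true := by
    intro x y q hx hxy
    rcases hxy.eq_or_lt with rfl | hlt
    · exact hx
    by_contra hy
    have h1 := ha (x, q)
    have h2 := ha (y, q)
    rw [hx] at h1
    rw [Bool.eq_false_of_not_eq_true hy] at h2
    have h3 := (hle x q).1
    have h4 := (hle y q).2
    rw [M.actionValue_true] at h1 h4
    rw [M.actionValue_false] at h2 h3
    have h5 := hgap x y q hxy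
    have h6 : ((x : ℕ) : ℝ) < ((y : ℕ) : ℝ) := by exact_mod_cast hlt
    linarith
  have hex : ∀ q, ∃ x : ℕ+, a (x, q) = true := by
    intro q
    by_contra! hno
    obtain ⟨n, hn⟩ := exists_nat_ge (M.W + M.lam * M.ω q +
      ∑ q', (M.P q q').toReal * V (1, q') -
        ∑ q', (M.P q q').toReal * V (1 + 1, q'))
    have h2 := ha (1 + n.succPNat, q)
    rw [Bool.eq_false_of_not_eq_true (hno _)] at h2
    have h4 := (hle (1 + n.succPNat) q).2
    rw [M.actionValue_true] at h4
    rw [M.actionValue_false] at h2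
    have h5 := hgap 1 (1 + n.succPNat) q one_le
    push_cast [Nat.succPNat_coe] at *
    linarith
  refine ⟨fun q => PNat.find (hex q), fun x q => ⟨fun h => PNat.find_min' (hex q) h,
    fun h => hup _ x q (PNat.find_spec (hex q)) h⟩⟩

/-- The correction `δ x (x - 1) / 2` grows by exactly `δ x` when idling and drops to 0 when
scheduling, so `δ` times the cost pays for it. The bracket on the left is the Bellman gap, kept for
use in `attains_of_visitedFrom`. -/
theorem IsBellmanSolution.exists_lyapunov (hV : M.IsBellmanSolution γ V)
    (hK : ∀ q, 0 ≤ M.W + M.lam * M.ω q) {δ : ℝ} (hδ : 0 < δ) :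
    ∃ (U : State Q → ℝ) (S : ℝ), (∀ z, U z ≤ S) ∧ ∀ z s,
      U z + γ + (M.actionValue V z s - V z - γ) ≤
        (1 + δ) * M.cost z s + ∑ q', (M.P z.2 q').toReal * U (nextAge z.1 s, q') := by
  obtain ⟨C, hC⟩ := hV.exists_le_age_add
  refine ⟨fun z => V z + -(δ * (((z.1 : ℕ) : ℝ) * (((z.1 : ℕ) : ℝ) - 1) / 2)),
    -- The fraction is the maximum over real `x` of `x - δ x (x - 1) / 2`.
    C + (1 + δ / 2) ^ 2 / (2 * δ), ?_, ?_⟩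
  · rintro ⟨x, q⟩
    have h1 := hC x q
    have h2 : ((x : ℕ) : ℝ) - δ * (((x : ℕ) : ℝ) * (((x : ℕ) : ℝ) - 1) / 2) ≤
        (1 + δ / 2) ^ 2 / (2 * δ) := by
      rw [le_div_iff₀ (by positivity)]
      nlinarith [sq_nonneg (δ * ((x : ℕ) : ℝ) - (1 + δ / 2))]
    dsimp only
    linarith
  · rintro ⟨x, q⟩ s
    dsimp only
    rw [M.sum_P_mul_add_const]
    have hx : (1 : ℝ) ≤ ((x : ℕ) : ℝ) := by exact_mod_cast x.2
    cases s with
    | false =>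
      simp only [actionValue, cost, act, nextAge, Bool.false_eq_true, if_false]
      push_cast
      linarith
    | true =>
      simp only [actionValue, cost, act, nextAge, if_true]
      have h1 : 0 ≤ δ * (((x : ℕ) : ℝ) * (((x : ℕ) : ℝ) - 1) / 2) :=
        mul_nonneg hδ.le (by nlinarith)
      have h2 := mul_nonneg hδ.le (hK q)
      have h3 : 0 ≤ δ * ((x : ℕ) : ℝ) := by positivity
      simp only [PNat.one_coe, Nat.cast_one]
      linarith

theorem IsBellmanSolution.le_actionValue (hV : M.IsBellmanSolution γ V) (z : State Q) (s : Bool) :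
    V z + γ ≤ M.actionValue V z s := by
  have h := le_min_iff.1 (hV.2 z).le
  cases s
  exacts [h.1, h.2]

theorem IsBellmanSolution.eventually_le_average (hV : M.IsBellmanSolution γ V)
    (hK : ∀ q, 0 ≤ M.W + M.lam * M.ω q) {γ' : ℝ} (hγ' : γ' < γ) (π : Policy Q)
    (z₀ : State Q) : ∀ᶠ T in atTop, γ' ≤ M.average π z₀ M.cost T := by
  have habs : 0 < 1 + |γ'| := by positivity
  -- Small enough that `(1 + δ) γ' < γ`; the added 1 makes this strict.
  set δ := (γ - γ') / (1 + |γ'|)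
  have hδ : 0 < δ := div_pos (sub_pos.2 hγ') habs
  have hδ' : δ * (1 + |γ'|) = γ - γ' := div_mul_cancel₀ _ habs.ne'
  have hlt : (1 + δ) * γ' < γ := by linarith [mul_le_mul_of_nonneg_left (le_abs_self γ') hδ.le]
  obtain ⟨U, S, hS, hU⟩ := hV.exists_lyapunov hK hδ
  have hlim : Tendsto (fun T : ℕ => γ + (U z₀ - S) * (1 / (T : ℝ))) atTop (𝓝 γ) := by
    simpa using (tendsto_one_div_atTop_nhds_zero_nat (𝕜 := ℝ)).const_mul (U z₀ - S)
      |>.const_add γ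
  filter_upwards [hlim.eventually_const_lt hlt, eventually_ne_atTop 0] with T h1 hT
  have h2 := M.drift_le_average (π := π) (z₀ := z₀)
    -- The null term only fits the shape of `average_linear`.
    (f := fun z s => (1 + δ) * M.cost z s + 0 * M.cost z s) (U := U) (γ := γ)
    (fun h s _ => by linarith [hU h.cur s, hV.le_actionValue h.cur s]) hS hT
  rw [M.average_linear] at h2
  have h3 : 0 < 1 + δ := by linarith
  refine le_of_mul_le_mul_left ?_ h3
  linarith

/-- For the upper bound the drift inequality is applied to `-V` and the negated cost; `-V` is
bounded above because `V` is bounded below. -/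
theorem IsBellmanSolution.tendsto_average (hV : M.IsBellmanSolution γ V)
    (hK : ∀ q, 0 ≤ M.W + M.lam * M.ω q) {a : State Q → Bool} (ha : M.AttainsBellman γ V a)
    (z₀ : State Q) : Tendsto (M.average (stationary a) z₀ M.cost) atTop (𝓝 γ) := by
  obtain ⟨B, hB⟩ := hV.1
  have hdrift : ∀ h : History Q, ∀ s ∈ (stationary a h).support, (fun z => -V z) h.cur + -γ ≤
      (fun z s => (-1) * M.cost z s + 0 * M.cost z s) h.cur s +
        ∑ q', (M.P h.cur.2 q').toReal * (fun z => -V z) (nextAge h.cur.1 s, q') := by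
    intro h s hs
    obtain rfl : s = a h.cur := by simpa [stationary] using hs
    have h1 := ha h.cur
    rw [actionValue] at h1
    simp only [mul_neg, Finset.sum_neg_distrib]
    linarith
  have hupper : ∀ᶠ T : ℕ in atTop, M.average (stationary a) z₀ M.cost T ≤
      γ + (V z₀ - B) * (1 / (T : ℝ)) := by
    filter_upwards [eventually_ne_atTop 0] with T hT
    have h1 := M.drift_le_average (z₀ := z₀)
      (f := fun z s => (-1) * M.cost z s + 0 * M.cost z s) (U := fun z => -V z) hdrift (S := -B)
      (fun z => neg_le_neg (hB z)) hT
    rw [M.average_linear] at h1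
    linarith
  have hlim : Tendsto (fun T : ℕ => γ + (V z₀ - B) * (1 / (T : ℝ))) atTop (𝓝 γ) := by
    simpa using (tendsto_one_div_atTop_nhds_zero_nat (𝕜 := ℝ)).const_mul (V z₀ - B)
      |>.const_add γ
  rw [tendsto_order]
  refine ⟨fun γ' hγ' => ?_, fun γ' hγ' => ?_⟩
  · obtain ⟨c, hc, hc'⟩ := exists_between hγ'
    exact (hV.eventually_le_average hK hc' _ z₀).mono fun T h => hc.trans_le h
  · filter_upwards [hupper, hlim.eventually_lt_const hγ'] with T h1 h2
    exact h1.trans_lt h2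

theorem IsBellmanSolution.isOptimalFrom (hV : M.IsBellmanSolution γ V)
    (hK : ∀ q, 0 ≤ M.W + M.lam * M.ω q) {a : State Q → Bool} (ha : M.AttainsBellman γ V a)
    (z₀ : State Q) : M.IsOptimalFrom (stationary a) z₀ γ := by
  refine ⟨hV.tendsto_average hK ha z₀, fun π => ?_⟩
  refine le_of_forall_lt fun c hc => ?_
  obtain ⟨γ', h1, h2⟩ := EReal.lt_iff_exists_real_btwn.1 hc
  refine h1.trans_le (le_liminf_of_le (by isBoundedDefault) ?_)
  filter_upwards [hV.eventually_le_average hK (EReal.coe_lt_coe_iff.1 h2) π z₀] with T hT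
  exact EReal.coe_le_coe_iff.2 hT

/-- Each visit to a state with a non-minimizing action wastes a fixed `ε > 0`. Up to a vanishing
error the average cost is at least `γ` plus `ε` times the visit frequency, so that frequency must
tend to 0. -/
theorem IsBellmanSolution.attains_of_visitedFrom (hV : M.IsBellmanSolution γ V)
    (hK : ∀ q, 0 ≤ M.W + M.lam * M.ω q) {a : State Q → Bool} {z₀ z : State Q}
    (ha : Tendsto (M.average (stationary a) z₀ M.cost) atTop (𝓝 γ))
    (hz : M.VisitedFrom (stationary a) z₀ z) : M.actionValue V z (a z) = V z + γ := by
  classical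
  by_contra hne
  refine hz ?_
  set ε := M.actionValue V z (a z) - V z - γ
  have hε : 0 < ε := by
    have := lt_of_le_of_ne (hV.le_actionValue z (a z)) (Ne.symm hne)
    linarith
  set ind : State Q → Bool → ℝ := fun y _ => if y = z then 1 else 0 with hind
  have hind_nonneg : ∀ T, 0 ≤ M.average (stationary a) z₀ ind T :=
    M.average_nonneg _ _ fun y _ => by simp only [hind]; split_ifs <;> norm_num
  have hsmall : ∀ η > 0, ∀ᶠ T in atTop, M.average (stationary a) z₀ ind T < η := by
    intro η hη
    have habs : 0 < 1 + |γ| := by positivity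
    set δ := ε * η / (1 + |γ|)
    have hδ : 0 < δ := by positivity
    have hδ' : δ * (1 + |γ|) = ε * η := div_mul_cancel₀ _ habs.ne'
    have hlt : (1 + δ) * γ - γ < ε * η := by
      linarith [mul_le_mul_of_nonneg_left (le_abs_self γ) hδ.le]
    obtain ⟨U, S, hS, hU⟩ := hV.exists_lyapunov hK hδ
    have hlim : Tendsto (fun T : ℕ => (1 + δ) * M.average (stationary a) z₀ M.cost T -
        (γ + (U z₀ - S) * (1 / (T : ℝ)))) atTop (𝓝 ((1 + δ) * γ - γ)) := by
      refine (ha.const_mul _).sub ?_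
      simpa using (tendsto_one_div_atTop_nhds_zero_nat (𝕜 := ℝ)).const_mul (U z₀ - S)
        |>.const_add γ
    filter_upwards [hlim.eventually_lt_const hlt, eventually_ne_atTop 0] with T h1 hT
    have hdrift : ∀ h : History Q, ∀ s ∈ (stationary a h).support, U h.cur + γ ≤
        (1 + δ) * M.cost h.cur s + (-ε) * ind h.cur s +
          ∑ q', (M.P h.cur.2 q').toReal * U (nextAge h.cur.1 s, q') := by
      intro h s hs
      obtain rfl : s = a h.cur := by simpa [stationary] using hs
      have h2 := hU h.cur (a h.cur)
      have h3 := hV.le_actionValue h.cur (a h.cur)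
      simp only [hind]
      split_ifs with hc
      · rw [hc] at h2 ⊢
        linarith
      · linarith
    have h2 := M.drift_le_average (z₀ := z₀)
      (f := fun z s => (1 + δ) * M.cost z s + (-ε) * ind z s) hdrift hS hT
    rw [M.average_linear] at h2
    refine lt_of_mul_lt_mul_left ?_ hε.le
    linarith
  have hlim : Tendsto (M.average (stationary a) z₀ ind) atTop (𝓝 0) := by
    rw [tendsto_order]
    exact ⟨fun c hc => Eventually.of_forall fun T => hc.trans_le (hind_nonneg T), hsmall⟩
  convert hlim

theorem exists_attainsBellman (hV : M.IsBellmanSolution γ V) :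
    ∃ a : State Q → Bool, M.AttainsBellman γ V a := by
  have h : ∀ z, ∃ s, M.actionValue V z s = V z + γ := fun z => by
    rcases min_choice (M.actionValue V z false) (M.actionValue V z true) with h | h
    exacts [⟨false, by rw [hV.2, h]⟩, ⟨true, by rw [hV.2, h]⟩]
  choose a ha using h
  exact ⟨a, ha⟩

theorem IsBellmanSolution.exists_threshold_of_isOptimalFrom (hV : M.IsBellmanSolution γ V)
    (hK : ∀ q, 0 ≤ M.W + M.lam * M.ω q) {a : State Q → Bool} {z₀ : State Q} {γ' : ℝ}
    (ha : M.IsOptimalFrom (stationary a) z₀ γ') :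
    ∃ τ : Q → ℕ+, ∀ (x : ℕ+) (q : Q),
      M.VisitedFrom (stationary a) z₀ (x, q) → (a (x, q) = true ↔ τ q ≤ x) := by
  classical
  obtain ⟨b, hb⟩ := exists_attainsBellman hV
  have hopt := hV.isOptimalFrom hK hb z₀
  obtain rfl : γ' = γ := le_antisymm (ha.le hopt) (hopt.le ha)
  -- Replacing `a` by a minimizer wherever it fails to attain leaves it unchanged on the frequently
  -- visited states.
  have hc : M.AttainsBellman γ' V
      fun z => if M.actionValue V z (a z) = V z + γ' then a z else b z := by
    intro z
    dsimp only
    split_ifs with h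
    exacts [h, hb z]
  obtain ⟨τ, hτ⟩ := hV.exists_threshold hK hc
  refine ⟨τ, fun x q hxq => ?_⟩
  rw [← hτ x q, if_pos (hV.attains_of_visitedFrom hK ha.1 hxq)]

end Model

/-! ### Existence of a Bellman solution by vanishing discount. -/

namespace Model

variable {Q : Type*} [Fintype Q] (M : Model Q)

/-- The Bellman operator with discount factor `β`. -/
def discountedBellman (β : ℝ) (V : State Q → ℝ) (z : State Q) : ℝ :=
  min (((z.1 : ℕ) : ℝ) + β * ∑ q', (M.P z.2 q').toReal * V (z.1 + 1, q'))
    (((z.1 : ℕ) : ℝ) + (M.W + M.lam * M.ω z.2) + β * ∑ q', (M.P z.2 q').toReal * V (1, q'))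

variable {M}

theorem discountedBellman_mono {β : ℝ} (hβ : 0 ≤ β) {V V' : State Q → ℝ} (h : V ≤ V') :
    M.discountedBellman β V ≤ M.discountedBellman β V' := fun z =>
  min_le_min (add_le_add_right (mul_le_mul_of_nonneg_left
    (M.sum_P_mul_mono z.2 fun _ => h _) hβ) _) (add_le_add_right (mul_le_mul_of_nonneg_left
    (M.sum_P_mul_mono z.2 fun _ => h _) hβ) _)

theorem tendsto_discountedBellman {ι : Type*} {l : Filter ι} {β : ι → ℝ} {β₀ : ℝ}
    (hβ : Tendsto β l (𝓝 β₀)) {V : ι → State Q → ℝ} {V₀ : State Q → ℝ}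
    (hV : ∀ z, Tendsto (fun i => V i z) l (𝓝 (V₀ z))) (z : State Q) :
    Tendsto (fun i => M.discountedBellman (β i) (V i) z) l
      (𝓝 (M.discountedBellman β₀ V₀ z)) := by
  have h : ∀ y : ℕ+, Tendsto (fun i => β i * ∑ q', (M.P z.2 q').toReal * V i (y, q')) l
      (𝓝 (β₀ * ∑ q', (M.P z.2 q').toReal * V₀ (y, q'))) := fun y =>
    hβ.mul (tendsto_finsetSum _ fun q' _ => (hV (y, q')).const_mul _)
  exact ((h _).const_add _).min ((h _).const_add _)

/-- The discounted problem has a nonnegative value function, monotone in the age. -/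
theorem exists_discounted_value (hK : ∀ q, 0 ≤ M.W + M.lam * M.ω q) {C : ℝ}
    (hC : ∀ q, 1 + (M.W + M.lam * M.ω q) ≤ C) (hC0 : 0 ≤ C) {β : ℝ} (hβ : 0 ≤ β) (hβ1 : β < 1) :
    ∃ V : State Q → ℝ, (∀ z, 0 ≤ V z) ∧ (∀ x q, V (1, q) ≤ V (x, q)) ∧
      (∀ x q, V (x, q) ≤ ((x : ℕ) : ℝ) + C / (1 - β)) ∧
      ∀ z, V z = M.discountedBellman β V z := by
  have hβ' : 0 < 1 - β := by linarith
  -- A supersolution, as the scheduling branch shows; it caps the value iteration started at 0.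
  set S : State Q → ℝ := fun z => ((z.1 : ℕ) : ℝ) + C / (1 - β) with hS
  have hF0 : (0 : State Q → ℝ) ≤ M.discountedBellman β 0 := by
    rintro ⟨x, q⟩
    have := hK q
    have hx : (0 : ℝ) ≤ ((x : ℕ) : ℝ) := by positivity
    simp only [discountedBellman, Pi.zero_apply, mul_zero, Finset.sum_const_zero, add_zero]
    exact le_min hx (by linarith)
  have hFS : M.discountedBellman β S ≤ S := by
    rintro ⟨x, q⟩
    refine (min_le_right _ _).trans ?_
    simp only [hS, M.sum_P_mul_const, PNat.one_coe, Nat.cast_one]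
    have h1 : C / (1 - β) * (1 - β) = C := div_mul_cancel₀ _ hβ'.ne'
    have h2 := hC q
    linarith
  set v : ℕ → State Q → ℝ := fun n => (M.discountedBellman β)^[n] 0 with hv
  have hsucc : ∀ n, v (n + 1) = M.discountedBellman β (v n) := fun n =>
    Function.iterate_succ_apply' _ _ _
  have hmono : Monotone v := by
    refine monotone_nat_of_le_succ fun n => ?_
    induction n with
    | zero => exact hF0
    | succ n ih =>
      rw [hsucc, hsucc (n + 1)]
      exact discountedBellman_mono hβ ih
  have hle : ∀ n, v n ≤ S := by
    intro n
    induction n with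
    | zero =>
      exact fun z => by
        simp only [hS, hv, Function.iterate_zero, id, Pi.zero_apply]
        positivity
    | succ n ih =>
      rw [hsucc]
      exact (discountedBellman_mono hβ ih).trans hFS
  have hage : ∀ n (x y : ℕ+) q, x ≤ y → v n (x, q) ≤ v n (y, q) := by
    intro n
    induction n with
    | zero => exact fun x y q _ => le_rfl
    | succ n ih =>
      intro x y q hxy
      rw [hsucc]
      have hxy' : ((x : ℕ) : ℝ) ≤ ((y : ℕ) : ℝ) := by exact_mod_cast hxy
      have h1 := mul_le_mul_of_nonneg_left
        (M.sum_P_mul_mono q fun q' => ih (x + 1) (y + 1) q' (add_le_add_left hxy 1)) hβ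
      exact min_le_min (add_le_add hxy' h1) (by dsimp only; linarith)
  have hbdd : ∀ z, BddAbove (Set.range fun n => v n z) := fun z =>
    ⟨S z, by rintro _ ⟨n, rfl⟩; exact hle n z⟩
  have hlim : ∀ z, Tendsto (fun n => v n z) atTop (𝓝 (⨆ n, v n z)) := fun z =>
    tendsto_atTop_ciSup (fun m n h => hmono h z) (hbdd z)
  refine ⟨fun z => ⨆ n, v n z, fun z => le_ciSup (hbdd z) 0, fun x q => ?_, fun x q => ?_,
    fun z => ?_⟩
  · exact ciSup_mono (hbdd _) fun n => hage n 1 x q one_le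
  · exact ciSup_le fun n => hle n (x, q)
  · refine tendsto_nhds_unique ((tendsto_add_atTop_iff_nat 1).2 (hlim z)) ?_
    simp only [hsucc]
    exact tendsto_discountedBellman tendsto_const_nhds hlim z

/-- In an irreducible chain, nonnegative functions with a zero whose drift is at least `-C` are
uniformly bounded. -/
theorem Irreducible.exists_bound [Nonempty Q] (hP : M.Irreducible) {C : ℝ} (hC : 0 ≤ C) :
    ∃ R : ℝ, ∀ w : Q → ℝ, (∀ q, 0 ≤ w q) → (∃ q, w q = 0) →
      (∀ q, w q ≤ C + ∑ q', (M.P q q').toReal * w q') → ∀ q, w q ≤ R := by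
  -- Induction along a path from `i` to the zero `j`: each edge passes on a share of the gain over
  -- the maximum `m`. The constants do not depend on `w`, so taking `m = w i` at a maximizer `i`
  -- gives `w i ≤ A / ε`.
  have key : ∀ i j, ∃ A ε : ℝ, 0 ≤ A ∧ 0 < ε ∧ ∀ w : Q → ℝ, (∀ q, 0 ≤ w q) → w j = 0 →
      (∀ q, w q ≤ C + ∑ q', (M.P q q').toReal * w q') →
        ∀ m, (∀ q, w q ≤ m) → w i ≤ A + (1 - ε) * m := by
    intro i j
    induction hP i j using Relation.ReflTransGen.head_induction_on with
    | refl =>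
      exact ⟨0, 1, le_rfl, one_pos, fun w _ hj _ m _ => by rw [hj]; simp⟩
    | @head i k hik _ ih =>
      obtain ⟨A, ε, hA, hε, h⟩ := ih
      have hp : 0 < (M.P i k).toReal := ENNReal.toReal_pos hik ((M.P i).apply_ne_top k)
      refine ⟨C + (M.P i k).toReal * A, (M.P i k).toReal * ε, by positivity, by positivity,
        fun w hw hj hdrift m hm => ?_⟩
      classical
      have h1 := h w hw hj hdrift m hm
      have h2 := hdrift i
      have h3 : ∑ q', (M.P i q').toReal * w q' + (M.P i k).toReal * (m - w k) ≤ m := by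
        have h4 : ∑ q', (M.P i q').toReal * (m - w q') =
            m - ∑ q', (M.P i q').toReal * w q' := by
          simp only [mul_sub, Finset.sum_sub_distrib, M.sum_P_mul_const]
        have h5 := Finset.single_le_sum (s := Finset.univ)
          (f := fun q' => (M.P i q').toReal * (m - w q'))
          (fun q' _ => mul_nonneg ENNReal.toReal_nonneg (sub_nonneg.2 (hm q')))
          (Finset.mem_univ k)
        linarith
      nlinarith [mul_le_mul_of_nonneg_left h1 hp.le]
  choose A ε hA hε h using key
  obtain ⟨R, hR⟩ := (Set.finite_range fun p : Q × Q => A p.1 p.2 / ε p.1 p.2).bddAbove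
  refine ⟨R, fun w hw ⟨j, hj⟩ hdrift q => ?_⟩
  obtain ⟨i, hi⟩ := Finite.exists_max w
  have h1 := h i j w hw hj hdrift (w i) hi
  have h2 : w i ≤ A i j / ε i j := by
    rw [le_div_iff₀ (hε i j)]
    linarith
  exact (hi q).trans (h2.trans (hR ⟨(i, j), rfl⟩))

/-- Subtracting the least age-one discounted value leaves nonnegative functions with a zero at age
one, to which `Irreducible.exists_bound` applies. The constant removed reappears as `(1 - β) V (1,
j)`, which stays bounded and converges to `γ`. -/
theorem exists_isBellmanSolution [Nonempty Q] (hP : M.Irreducible)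
    (hK : ∀ q, 0 ≤ M.W + M.lam * M.ω q) :
    ∃ (γ : ℝ) (V : State Q → ℝ), M.IsBellmanSolution γ V := by
  obtain ⟨C, hC⟩ := (Set.finite_range fun q => 1 + (M.W + M.lam * M.ω q)).bddAbove
  replace hC : ∀ q, 1 + (M.W + M.lam * M.ω q) ≤ C := fun q => hC ⟨q, rfl⟩
  have hC0 : 0 ≤ C := by
    obtain ⟨q⟩ := ‹Nonempty Q›
    linarith [hC q, hK q]
  obtain ⟨R, hR⟩ := hP.exists_bound hC0
  -- relative discounted values, bounded uniformly in the discount factor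
  have hrel : ∀ β : ℝ, 0 ≤ β → β < 1 → ∃ (w : State Q → ℝ) (g : ℝ), 0 ≤ g ∧ g ≤ 1 + C ∧
      (∀ z, 0 ≤ w z) ∧ (∀ z, w z ≤ ((z.1 : ℕ) : ℝ) + (C + |R|)) ∧
      ∀ z, w z + g = M.discountedBellman β w z := by
    intro β hβ hβ1
    obtain ⟨V, hV0, hVage, hVle, hVeq⟩ := exists_discounted_value hK hC hC0 hβ hβ1
    obtain ⟨j, hj⟩ := Finite.exists_min fun q => V (1, q)
    have hβ' : 0 < 1 - β := by linarith
    have hg0 : 0 ≤ (1 - β) * V (1, j) := mul_nonneg hβ'.le (hV0 _)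
    have hw0 : ∀ z, 0 ≤ V z + -V (1, j) := by
      rintro ⟨x, q⟩
      linarith [hj q, hVage x q]
    have hweq : ∀ z, V z + -V (1, j) + (1 - β) * V (1, j) =
        M.discountedBellman β (fun z => V z + -V (1, j)) z := by
      intro z
      rw [hVeq z, discountedBellman, discountedBellman]
      simp only [M.sum_P_mul_add_const]
      rw [add_assoc, ← min_add_add_right]
      congr 1 <;> ring
    have hdrop : ∀ (x : ℕ+) (q : Q), V (x, q) + -V (1, j) ≤ ((x : ℕ) : ℝ) +
        (M.W + M.lam * M.ω q) + ∑ q', (M.P q q').toReal * (V (1, q') + -V (1, j)) := by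
      intro x q
      have h1 := (hweq (x, q)).le.trans (min_le_right _ _)
      have h2 : 0 ≤ ∑ q', (M.P q q').toReal * (V (1, q') + -V (1, j)) :=
        Finset.sum_nonneg fun q' _ => mul_nonneg ENNReal.toReal_nonneg (hw0 _)
      have h3 := mul_le_mul_of_nonneg_right hβ1.le h2
      linarith
    have hwR := hR (fun q => V (1, q) + -V (1, j)) (fun q => hw0 _) ⟨j, add_neg_cancel _⟩
      fun q => by
        have h1 := hdrop 1 q
        have h2 := hC q
        simp only [PNat.one_coe, Nat.cast_one] at h1
        linarith
    refine ⟨fun z => V z + -V (1, j), (1 - β) * V (1, j), hg0, ?_, hw0, ?_, hweq⟩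
    · have h1 := mul_le_mul_of_nonneg_left (hVle 1 j) hβ'.le
      have h2 : (1 - β) * (C / (1 - β)) = C := mul_div_cancel₀ _ hβ'.ne'
      simp only [PNat.one_coe, Nat.cast_one] at h1
      linarith
    · rintro ⟨x, q⟩
      have h1 := M.sum_P_mul_mono q hwR
      rw [M.sum_P_mul_const] at h1
      linarith [hdrop x q, hC q, le_abs_self R]
  have hb : ∀ n : ℕ, 0 < 1 / ((n : ℝ) + 1) ∧ 1 / ((n : ℝ) + 1) ≤ 1 := fun n =>
    ⟨by positivity, by rw [div_le_one (by positivity)]; linarith [n.cast_nonneg (α := ℝ)]⟩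
  choose w g hg0 hg hw0 hw heq using fun n : ℕ =>
    hrel (1 - 1 / ((n : ℝ) + 1)) (by linarith [hb n]) (by linarith [hb n])
  -- A limit along one ultrafilter exists for every bounded sequence, so all states converge
  -- together without a diagonal extraction.
  have hlim : ∀ (u : ℕ → ℝ) (c : ℝ), (∀ n, 0 ≤ u n) → (∀ n, u n ≤ c) →
      ∃ L, 0 ≤ L ∧ Tendsto u (hyperfilter ℕ : Filter ℕ) (𝓝 L) := by
    intro u c h0 hc
    obtain ⟨L, hL, h⟩ := (isCompact_Icc (a := (0 : ℝ)) (b := c)).ultrafilter_le_nhds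
      ((hyperfilter ℕ).map u) (by
        rw [le_principal_iff]
        exact mem_map.2 (univ_mem' fun n => ⟨h0 n, hc n⟩))
    exact ⟨L, hL.1, h⟩
  obtain ⟨γ, -, hγ⟩ := hlim g (1 + C) hg0 hg
  choose V hV0 hV using fun z => hlim (fun n => w n z) _ (fun n => hw0 n z) fun n => hw n z
  have hβ : Tendsto (fun n : ℕ => 1 - 1 / ((n : ℝ) + 1)) (hyperfilter ℕ : Filter ℕ) (𝓝 1) := by
    have h := (tendsto_one_div_add_atTop_nhds_zero_nat (𝕜 := ℝ)).const_sub 1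
    rw [sub_zero] at h
    exact h.mono_left (Nat.hyperfilter_le_atTop)
  refine ⟨γ, V, ⟨0, hV0⟩, fun ⟨x, q⟩ => ?_⟩
  have h1 := tendsto_nhds_unique ((hV (x, q)).add hγ)
    ((tendsto_discountedBellman hβ hV (x, q)).congr fun n => (heq n (x, q)).symm)
  rw [h1, M.actionValue_false, M.actionValue_true, discountedBellman]
  simp only [one_mul]

end Model

end AoI

end

theorem lemma1 {Q : Type*} [Fintype Q] [Nonempty Q] (M : AoI.Model Q)
    (hP : M.Irreducible) (hω : ∀ q, 0 ≤ M.ω q) (hW : 0 ≤ M.W) (hlam : 0 ≤ M.lam) :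
    -- the Bellman equation has a solution, with a stationary deterministic policy attaining it
    (∃ (γ : ℝ) (V : AoI.State Q → ℝ) (a : AoI.State Q → Bool),
      M.IsBellmanSolution γ V ∧ M.AttainsBellman γ V a) ∧
    -- every such policy is average-cost optimal and of threshold type
    (∀ (γ : ℝ) (V : AoI.State Q → ℝ) (a : AoI.State Q → Bool),
      M.IsBellmanSolution γ V → M.AttainsBellman γ V a →
        (∀ z₀, M.IsOptimalFrom (AoI.stationary a) z₀ γ) ∧
        ∃ τ : Q → ℕ+, ∀ (x : ℕ+) (q : Q), a (x, q) = true ↔ τ q ≤ x) ∧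
    -- every average-cost optimal stationary deterministic policy is of threshold type on the
    -- states that it visits with positive long-run frequency
    (∀ (a : AoI.State Q → Bool) (z₀ : AoI.State Q) (γ : ℝ),
      M.IsOptimalFrom (AoI.stationary a) z₀ γ →
        ∃ τ : Q → ℕ+, ∀ (x : ℕ+) (q : Q),
          M.VisitedFrom (AoI.stationary a) z₀ (x, q) → (a (x, q) = true ↔ τ q ≤ x)) := by
  have hK : ∀ q, 0 ≤ M.W + M.lam * M.ω q := fun q => add_nonneg hW (mul_nonneg hlam (hω q))
  obtain ⟨γ₀, V₀, hV₀⟩ := AoI.Model.exists_isBellmanSolution hP hK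
  refine ⟨?_, fun γ V a hV ha => ⟨hV.isOptimalFrom hK ha, hV.exists_threshold hK ha⟩,
    fun a z₀ γ ha => hV₀.exists_threshold_of_isOptimalFrom hK ha⟩
  obtain ⟨a, ha⟩ := AoI.Model.exists_attainsBellman hV₀
  exact ⟨γ₀, V₀, a, hV₀, ha⟩
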